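/- For integers $n,m\ge 0$, let $D_{2,2}(n,m)$ be the number of partitions $n=\lambda_1+\cdots+\lambda_m$, $1\le\lambda_1\le\cdots\le\lambda_m$, of $n$ into $m$ parts such that for all $1\le i<m$ one has $\lambda_{i+1}-\lambda_i\ge 2$, and $\lambda_{i+1}-\lambda_i\ge 3$ unless $\lambda_i$ and $\lambda_{i+1}$ are both odd. Let $D_{2,1}(n,m)$ be the number of those partitions counted by $D_{2,2}(n,m)$ in which all parts are at least $3$. (The empty partition is counted, so $D_{2,2}(0,0)=D_{2,1}(0,0)=1$.) Write $(a;q)_k=\prod_{j=1}^{k}(1-aq^{j-1})$. Then, as identities of formal power series in $q$ and $x$ with integer coefficients (in each double series on the right, only finitely many terms contribute to any given coefficient), $$\sum_{m,n\ge 0} D_{2,2}(n,m)\,q^n x^m=\sum_{n_1,n_2\ge 0}\frac{q^{4n_2^2+(3n_1^2-n_1)/2+4n_2n_1}\,x^{2n_2+n_1}}{(q;q)_{n_1}\,(q^4;q^4)_{n_2}}$$ and $$\sum_{m,n\ge 0} D_{2,1}(n,m)\,q^n x^m=\sum_{n_1,n_2\ge 0}\frac{q^{4n_2^2+4n_2+(3n_1^2+3n_1)/2+4n_2n_1}\,x^{2n_2+n_1}}{(q;q)_{n_1}\,(q^4;q^4)_{n_2}}.$$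 -/

import Mathlib

open scoped MvPowerSeries.WithPiTopology

/-- The `q`-Pochhammer symbol `(a; q)_n = ∏_{j=1}^{n} (1 - a q^{j-1})`. -/
def qPochhammer {R : Type*} [CommRing R] (a q : R) (n : ℕ) : R :=
  ∏ j ∈ Finset.range n, (1 - a * q ^ j)

/-- Condition on two successive parts `a`, `b` (`a` the smaller one): the difference `b - a` is at
least two, and it is at least three unless both parts are odd. -/
def GGDiff (a b : ℕ) : Prop :=
  a + 2 ≤ b ∧ (¬ (Odd a ∧ Odd b) → a + 3 ≤ b)

/-- The partitions of `n` into `m` parts such that, when the parts are listed in non-decreasing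
order, any two successive parts satisfy `GGDiff`. -/
def ggPartitions (n m : ℕ) : Set n.Partition :=
  {p | p.parts.card = m ∧ (p.parts.sort (· ≤ ·)).IsChain GGDiff}

/-- `D_{2,2}(n, m)`. -/
noncomputable def D22 (n m : ℕ) : ℕ :=
  (ggPartitions n m).ncard

/-- `D_{2,1}(n, m)`: all the parts have to be at least three. -/
noncomputable def D21 (n m : ℕ) : ℕ :=
  {p ∈ ggPartitions n m | ∀ a ∈ p.parts, 3 ≤ a}.ncard

/-- The ring `ℤ⟦q, x⟧` of formal power series in two variables. With the product topology (from
the discrete `ℤ`), a sum converges exactly when each coefficient of it is a finite sum. -/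
abbrev QXSeries : Type := MvPowerSeries (Fin 2) ℤ

/-- The variable `q`. -/
noncomputable def qVar : QXSeries := MvPowerSeries.X 0

/-- The variable `x`. -/
noncomputable def xVar : QXSeries := MvPowerSeries.X 1

/-- The generating function `∑_{m, n ≥ 0} D(n, m) q^n x^m`: the coefficient of `q^n x^m`
is `D(n, m)`. -/
def genFun (D : ℕ → ℕ → ℕ) : QXSeries :=
  fun e => (D (e 0) (e 1) : ℤ)

/-- The series `genFun D` is indeed the sum of its terms `D(n, m) q^n x^m`. -/
theorem hasSum_genFun (D : ℕ → ℕ → ℕ) :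
    HasSum (fun p : ℕ × ℕ => (D p.1 p.2 : QXSeries) * (qVar ^ p.1 * xVar ^ p.2)) (genFun D) := by
  have h := MvPowerSeries.WithPiTopology.hasSum_of_monomials_self (genFun D)
  let e : ℕ × ℕ ≃ (Fin 2 →₀ ℕ) :=
    (finTwoArrowEquiv ℕ).symm.trans Finsupp.equivFunOnFinite.symm
  rw [← e.hasSum_iff] at h
  convert h using 1
  funext p
  have he : e p = Finsupp.single 0 p.1 + Finsupp.single 1 p.2 := by
    ext i
    fin_cases i <;> simp [e]
  have h0 : e p 0 = p.1 := by simp [he]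
  have h1 : e p 1 = p.2 := by simp [he]
  have hc : MvPowerSeries.coeff (e p) (genFun D) = (D p.1 p.2 : ℤ) := by
    rw [← h0, ← h1]; rfl
  rw [Function.comp_apply, hc, he, qVar, xVar, MvPowerSeries.X_pow_eq, MvPowerSeries.X_pow_eq,
    MvPowerSeries.monomial_mul_monomial, ← nsmul_eq_mul, ← map_nsmul]
  simp

/-- The denominator `(q; q)_{n₁} (q⁴; q⁴)_{n₂}`. -/
noncomputable def ggDenom (n₁ n₂ : ℕ) : QXSeries :=
  qPochhammer qVar qVar n₁ * qPochhammer (qVar ^ 4) (qVar ^ 4) n₂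

/-- Its reciprocal `1 / ((q; q)_{n₁} (q⁴; q⁴)_{n₂})`, the denominator having constant
coefficient `1`. -/
noncomputable def ggDenomInv (n₁ n₂ : ℕ) : QXSeries :=
  MvPowerSeries.invOfUnit (ggDenom n₁ n₂) 1

/-- `ggDenomInv` is the multiplicative inverse of the denominator. -/
theorem ggDenom_mul_inv (n₁ n₂ : ℕ) : ggDenom n₁ n₂ * ggDenomInv n₁ n₂ = 1 := by
  apply MvPowerSeries.mul_invOfUnit
  simp [ggDenom, qPochhammer, qVar, map_prod]

/-! Compare the coefficients of `x ^ N`; both are power series in `q` determined by value `1` at `N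
= 0` and one first-order recurrence in `N`. Partitions: the smallest part is 1, 2 or at least 3, and
the rest has parts at least 3 or 5 in the first two cases. Subtracting 2 from every part preserves
parities, hence `GGDiff`, so the series `G_N` of lists with `N` parts satisfies `(1 - q^(2N+2))
G_(N+1) = (q^(2N+1) + q^(4N+2)) G_N` (`ggSeries_recurrence`). Sums: with `N = 2b + a` the exponent
is `N² + a.choose 2`, so by Euler the inner sum is `q^(N²)` times the coefficient of `z^N` in `(-z;
q)_∞ / (z²; q⁴)_∞`. The functional equation of this quotient under `z ↦ q² z` gives the same
recurrence (`sum_weightPairs_succ`). The second identity is the first one shifted by 2 in every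
part. -/

/-! ### Functional equations of the Euler products -/

section Recurrence

open PowerSeries

/-- The pairs `(a, b)` with `2 b + a = N`. -/
def weightPairs (N : ℕ) : Finset (ℕ × ℕ) :=
  (Finset.range (N + 1) ×ˢ Finset.range (N + 1)).filter fun p => 2 * p.2 + p.1 = N

theorem mem_weightPairs {N : ℕ} {p : ℕ × ℕ} : p ∈ weightPairs N ↔ 2 * p.2 + p.1 = N := by
  simp only [weightPairs, Finset.mem_filter, Finset.mem_product, Finset.mem_range]
  omega

variable {R : Type*} [CommRing R] {q : R} {u v : ℕ → R}

/-- The sequence `v` spread over the even exponents. -/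
def evenSeries (v : ℕ → R) : R⟦X⟧ := mk fun n => if Even n then v (n / 2) else 0

/-- This is `(-z; q)_∞ = (1 + z) (-zq; q)_∞`, read off coefficientwise so that no infinite product
is needed. -/
theorem mk_eq_one_add_X_mul_rescale (hu : ∀ a, (1 - q ^ (a + 1)) * u (a + 1) = u a) :
    (mk fun a => q ^ a.choose 2 * u a) =
      (1 + X) * rescale q (mk fun a => q ^ a.choose 2 * u a) := by
  ext n
  cases n with
  | zero =>
    rw [add_mul, one_mul, map_add, coeff_zero_X_mul, coeff_rescale, pow_zero, one_mul, add_zero]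
  | succ n =>
    rw [add_mul, one_mul, map_add, coeff_succ_X_mul, coeff_rescale, coeff_rescale, coeff_mk,
      coeff_mk, ← hu n, Nat.choose_succ_succ' n 1, Nat.choose_one_right]
    ring

/-- The functional equation of `1 / (z²; q⁴)_∞`: replacing `z` by `q² z` removes the factor `1 / (1
- z²)`. -/
theorem one_sub_X_sq_mul_evenSeries (hv : ∀ b, (1 - q ^ (4 * (b + 1))) * v (b + 1) = v b) :
    (1 - X ^ 2) * evenSeries v = rescale (q ^ 2) (evenSeries v) := by
  ext n
  rw [sub_mul, one_mul, map_sub, coeff_X_pow_mul', coeff_rescale]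
  simp only [evenSeries, coeff_mk]
  rcases Nat.even_or_odd' n with ⟨b, rfl | rfl⟩
  · cases b with
    | zero => simp
    | succ b =>
      have h1 : 2 * (b + 1) - 2 = 2 * b := by omega
      simp only [h1, even_two, Even.mul_right, if_true, Nat.mul_div_cancel_left, two_pos]
      rw [if_pos (by omega), ← hv b]
      ring
  · have h1 : ¬ Even (2 * b + 1) := by simp
    have h2 : 2 ≤ 2 * b + 1 → ¬ Even (2 * b + 1 - 2) := by
      intro h
      rw [Nat.even_sub h]
      simp
    simp only [h1, if_false, mul_zero, zero_sub, neg_eq_zero, ite_eq_right_iff]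
    intro h3 h4
    exact absurd h4 (h2 h3)

theorem coeff_mk_mul_evenSeries (w : ℕ → R) (N : ℕ) :
    coeff N (mk w * evenSeries v) = ∑ p ∈ weightPairs N, w p.1 * v p.2 := by
  rw [coeff_mul]
  simp only [evenSeries, coeff_mk, mul_ite, mul_zero]
  rw [← Finset.sum_filter]
  symm
  refine Finset.sum_bij' (fun p _ => (p.1, 2 * p.2)) (fun p _ => (p.1, p.2 / 2)) ?_ ?_ ?_ ?_ ?_
  · intro p hp
    rw [mem_weightPairs] at hp
    simp
    omega
  · intro p hp
    rw [Finset.mem_filter, Finset.HasAntidiagonal.mem_antidiagonal] at hp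
    obtain ⟨h, k, hk⟩ := hp
    rw [mem_weightPairs]
    dsimp only
    omega
  · intro p _
    simp
  · intro p hp
    rw [Finset.mem_filter] at hp
    exact Prod.ext rfl (Nat.two_mul_div_two_of_even hp.2)
  · intro p _
    simp

/-- A recurrence for the coefficients of `(-z; q)_∞ / (z²; q⁴)_∞ = (-zq; q²)_∞ / (z; q²)_∞`. -/
theorem sum_weightPairs_succ [IsDomain R] (hu : ∀ a, (1 - q ^ (a + 1)) * u (a + 1) = u a)
    (hv : ∀ b, (1 - q ^ (4 * (b + 1))) * v (b + 1) = v b) (N : ℕ) :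
    (1 - q ^ (2 * N + 2)) * ∑ p ∈ weightPairs (N + 1), q ^ p.1.choose 2 * u p.1 * v p.2 =
      (1 + q ^ (2 * N + 1)) * ∑ p ∈ weightPairs N, q ^ p.1.choose 2 * u p.1 * v p.2 := by
  set A : R⟦X⟧ := mk fun a => q ^ a.choose 2 * u a with hA
  have hA1 : A = (1 + X) * rescale q A := mk_eq_one_add_X_mul_rescale hu
  have hA2 : rescale q A = (1 + C q * X) * rescale (q ^ 2) A := by
    conv_lhs => rw [hA1]
    rw [map_mul, map_add, map_one, rescale_X, rescale_rescale, pow_two]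
  have hB := one_sub_X_sq_mul_evenSeries hv
  have hX : (1 + X : R⟦X⟧) ≠ 0 := fun h => by
    have := congrArg (coeff 0) h
    simp at this
  have key : (1 - X) * (A * evenSeries v) =
      (1 + C q * X) * rescale (q ^ 2) (A * evenSeries v) := by
    -- The factor `1 + z` is common to `1 - z²` and to the first factor split off `A`.
    apply mul_left_cancel₀ hX
    rw [map_mul, ← hB]
    linear_combination (1 - X ^ 2) * evenSeries v * hA1 +
      (1 - X ^ 2) * evenSeries v * (1 + X) * hA2
  have h := congrArg (coeff (N + 1)) key
  rw [sub_mul, one_mul, add_mul, one_mul, mul_assoc, map_sub, map_add, coeff_succ_X_mul,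
    coeff_C_mul, coeff_succ_X_mul, coeff_rescale, coeff_rescale, hA,
    coeff_mk_mul_evenSeries, coeff_mk_mul_evenSeries] at h
  linear_combination h

end Recurrence

/-! ### From fixed powers of `x` to the double series -/

open MvPowerSeries in
theorem coeff_qVar_pow_mul (k : ℕ) (f : QXSeries) (e : Fin 2 →₀ ℕ) :
    coeff e (qVar ^ k * f) = if k ≤ e 0 then coeff (e - Finsupp.single 0 k) f else 0 := by
  rw [qVar, X_pow_eq, coeff_monomial_mul, one_mul]
  simp only [Finsupp.single_le_iff]

open MvPowerSeries in
theorem coeff_xVar_pow_mul (k : ℕ) (f : QXSeries) (e : Fin 2 →₀ ℕ) :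
    coeff e (xVar ^ k * f) = if k ≤ e 1 then coeff (e - Finsupp.single 1 k) f else 0 := by
  rw [xVar, X_pow_eq, coeff_monomial_mul, one_mul]
  simp only [Finsupp.single_le_iff]

/-- The series `∑ D(n) q^n`, in which `x` does not occur. -/
def qSeries (D : ℕ → ℕ) : QXSeries :=
  fun e => if e 1 = 0 then (D (e 0) : ℤ) else 0

theorem coeff_qSeries (D : ℕ → ℕ) (e : Fin 2 →₀ ℕ) :
    MvPowerSeries.coeff e (qSeries D) = if e 1 = 0 then (D (e 0) : ℤ) else 0 := rfl

theorem coeff_qVar_pow_mul_qSeries (k : ℕ) (D : ℕ → ℕ) (e : Fin 2 →₀ ℕ) :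
    MvPowerSeries.coeff e (qVar ^ k * qSeries D) =
      if e 1 = 0 then (if k ≤ e 0 then (D (e 0 - k) : ℤ) else 0) else 0 := by
  rw [coeff_qVar_pow_mul, coeff_qSeries]
  simp only [Finsupp.tsub_apply, Finsupp.single_eq_same, ne_eq, one_ne_zero, not_false_eq_true,
    Finsupp.single_eq_of_ne, tsub_zero]
  split_ifs <;> rfl

open MvPowerSeries in
theorem hasSum_genFun_of_sum_weightPairs (D : ℕ → ℕ → ℕ) (E : ℕ × ℕ → QXSeries)
    (h : ∀ N, ∑ p ∈ weightPairs N, E p = qSeries fun n => D n N) :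
    HasSum (fun p : ℕ × ℕ => xVar ^ (2 * p.2 + p.1) * E p) (genFun D) := by
  rw [WithPiTopology.hasSum_iff_hasSum_coeff]
  intro e
  have hdisj : Set.PairwiseDisjoint (Finset.range (e 1 + 1) : Set ℕ) weightPairs := by
    intro i _ j _ hij
    refine Finset.disjoint_left.2 fun p hp hq => hij ?_
    rw [mem_weightPairs] at hp hq
    exact hp.symm.trans hq
  convert hasSum_sum_of_ne_finset_zero
    (s := (Finset.range (e 1 + 1)).biUnion weightPairs) ?_ using 1
  · rw [Finset.sum_biUnion hdisj, Finset.sum_eq_single (e 1)]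
    · rw [Finset.sum_congr rfl (g := fun p => coeff e (xVar ^ (e 1) * E p)), ← map_sum,
        ← Finset.mul_sum, h, coeff_xVar_pow_mul, if_pos le_rfl, coeff_qSeries]
      · simp [genFun, coeff_apply]
      · intro p hp
        rw [mem_weightPairs.1 hp]
    -- For `N < e 1` a positive power of `x` would have to come from a series in `q` alone.
    · intro N hN hne
      rw [Finset.sum_congr rfl (g := fun p => coeff e (xVar ^ N * E p)), ← map_sum,
        ← Finset.mul_sum, h, coeff_xVar_pow_mul, coeff_qSeries]
      · rw [Finset.mem_range] at hN
        have : e 1 - N ≠ 0 := by omega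
        simp [this]
      · intro p hp
        rw [mem_weightPairs.1 hp]
    · simp
  · intro p hp
    rw [coeff_xVar_pow_mul, if_neg]
    simp only [Finset.mem_biUnion, mem_weightPairs, Finset.mem_range, not_exists, not_and] at hp
    intro hle
    exact hp _ (by omega) rfl
  · infer_instance

/-! ### Reciprocals of the denominators -/

theorem ggDenomInv_eq_of_mul_eq {a b : ℕ} {f : QXSeries} (h : ggDenom a b * f = 1) :
    ggDenomInv a b = f := by
  have h' := ggDenom_mul_inv a b
  calc ggDenomInv a b = (ggDenom a b * f) * ggDenomInv a b := by rw [h, one_mul]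
    _ = (ggDenom a b * ggDenomInv a b) * f := by ring
    _ = f := by rw [h', one_mul]

theorem qPochhammer_zero {R : Type*} [CommRing R] (a q : R) : qPochhammer a q 0 = 1 := by
  simp [qPochhammer]

theorem qPochhammer_succ {R : Type*} [CommRing R] (a q : R) (n : ℕ) :
    qPochhammer a q (n + 1) = qPochhammer a q n * (1 - a * q ^ n) := by
  simp [qPochhammer, Finset.prod_range_succ]

theorem ggDenomInv_eq_mul (a b : ℕ) : ggDenomInv a b = ggDenomInv a 0 * ggDenomInv 0 b := by
  apply ggDenomInv_eq_of_mul_eq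
  have h1 := ggDenom_mul_inv a 0
  have h2 := ggDenom_mul_inv 0 b
  simp only [ggDenom, qPochhammer_zero, mul_one, one_mul] at h1 h2 ⊢
  linear_combination h1 * (qPochhammer (qVar ^ 4) (qVar ^ 4) b * ggDenomInv 0 b) + h2

theorem ggDenomInv_zero_zero : ggDenomInv 0 0 = 1 :=
  ggDenomInv_eq_of_mul_eq (by simp [ggDenom, qPochhammer_zero])

theorem one_sub_mul_ggDenomInv_left (a : ℕ) :
    (1 - qVar ^ (a + 1)) * ggDenomInv (a + 1) 0 = ggDenomInv a 0 := by
  symm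
  apply ggDenomInv_eq_of_mul_eq
  refine Eq.trans ?_ (ggDenom_mul_inv (a + 1) 0)
  simp only [ggDenom, qPochhammer_succ]
  ring

theorem one_sub_mul_ggDenomInv_right (b : ℕ) :
    (1 - qVar ^ (4 * (b + 1))) * ggDenomInv 0 (b + 1) = ggDenomInv 0 b := by
  symm
  apply ggDenomInv_eq_of_mul_eq
  refine Eq.trans ?_ (ggDenom_mul_inv 0 (b + 1))
  simp only [ggDenom, qPochhammer_succ]
  ring

theorem one_sub_qVar_pow_ne_zero (k : ℕ) : (1 - qVar ^ (k + 1) : QXSeries) ≠ 0 := fun h => by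
  have := congrArg MvPowerSeries.constantCoeff h
  simp [qVar] at this

instance : IsDomain QXSeries := NoZeroDivisors.to_isDomain _

/-- A sequence of series satisfying the recurrence of `sum_weightPairs_succ` up to the factor
`q^{N²}` is the sequence of inner sums. -/
theorem sum_weightPairs_eq_of_recurrence (F : ℕ → QXSeries) (h0 : F 0 = 1)
    (hF : ∀ N, (1 - qVar ^ (2 * N + 2)) * F (N + 1) =
      qVar ^ (2 * N + 1) * (1 + qVar ^ (2 * N + 1)) * F N) (N : ℕ) :
    ∑ p ∈ weightPairs N, qVar ^ (N ^ 2 + p.1.choose 2) * ggDenomInv p.1 p.2 = F N := by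
  have hsum : ∀ N, ∑ p ∈ weightPairs N, qVar ^ (N ^ 2 + p.1.choose 2) * ggDenomInv p.1 p.2 =
      qVar ^ N ^ 2 * ∑ p ∈ weightPairs N,
        qVar ^ p.1.choose 2 * ggDenomInv p.1 0 * ggDenomInv 0 p.2 := by
    intro N
    rw [Finset.mul_sum]
    refine Finset.sum_congr rfl fun p _ => ?_
    rw [ggDenomInv_eq_mul]
    ring
  rw [hsum]
  induction N with
  | zero =>
    have : weightPairs 0 = {(0, 0)} := rfl
    simp [this, h0, ggDenomInv_zero_zero]
  | succ N ih =>
    apply mul_left_cancel₀ (one_sub_qVar_pow_ne_zero (2 * N + 1))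
    rw [hF, ← ih]
    have := sum_weightPairs_succ (q := qVar) (u := fun a => ggDenomInv a 0)
      (v := fun b => ggDenomInv 0 b) one_sub_mul_ggDenomInv_left
      one_sub_mul_ggDenomInv_right N
    -- The factor `q^(2N+1)` in `hF` is `q^((N+1)² - N²)`.
    linear_combination qVar ^ (N + 1) ^ 2 * this

/-! ### Combinatorics of the lists of parts -/

instance : IsTrans ℕ GGDiff :=
  ⟨fun a b c h₁ h₂ => ⟨by have := h₁.1; have := h₂.1; omega, fun _ => by
    have := h₁.1; have := h₂.1; omega⟩⟩

theorem GGDiff.add_two_iff {a b : ℕ} : GGDiff (a + 2) (b + 2) ↔ GGDiff a b := by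
  simp only [GGDiff, Nat.odd_iff]
  omega

theorem ggDiff_one_iff {b : ℕ} : GGDiff 1 b ↔ 3 ≤ b := by
  simp only [GGDiff, Nat.odd_iff, true_and]
  omega

theorem ggDiff_two_iff {b : ℕ} : GGDiff 2 b ↔ 5 ≤ b := by
  simp only [GGDiff, Nat.odd_iff]
  omega

/-- The lists of `m` parts, all at least `k`, with sum `n` and with successive differences
satisfying `GGDiff`. -/
def ggLists (k n m : ℕ) : Set (List ℕ) :=
  {l | l.Pairwise GGDiff ∧ (∀ a ∈ l, k ≤ a) ∧ l.length = m ∧ l.sum = n}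

theorem finite_ggLists (k n m : ℕ) : (ggLists k n m).Finite := by
  -- No entry exceeds the sum `n`, so the lists are words of length `m` over `Fin (n + 1)`.
  refine (List.finite_length_eq (Fin (n + 1)) m).image (List.map Fin.val) |>.subset ?_
  rintro l ⟨-, -, hl, hs⟩
  refine ⟨l.map (Fin.ofNat (n + 1)), by simp [hl], ?_⟩
  rw [List.map_map]
  conv_rhs => rw [← List.map_id l]
  refine List.map_congr_left fun a ha => ?_
  have := List.single_le_sum (fun _ _ => Nat.zero_le _) a ha
  simp [Nat.mod_eq_of_lt (show a < n + 1 by omega)]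

theorem ncard_ggPartitions_ge {k : ℕ} (hk : 1 ≤ k) (n m : ℕ) :
    {p ∈ ggPartitions n m | ∀ a ∈ p.parts, k ≤ a}.ncard = (ggLists k n m).ncard := by
  refine Set.ncard_congr (fun p _ => p.parts.sort (· ≤ ·)) ?_ ?_ ?_
  · rintro p ⟨⟨hc, hd⟩, ha⟩
    refine ⟨List.isChain_iff_pairwise.1 hd, by simpa using ha, by simpa using hc, ?_⟩
    rw [← Multiset.sum_coe, Multiset.sort_eq, p.parts_sum]
  · intro p p' _ _ h
    ext1
    rw [← Multiset.sort_eq p.parts (· ≤ ·), h, Multiset.sort_eq]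
  · rintro l ⟨hd, ha, hl, hs⟩
    have hsort : (l : Multiset ℕ).sort (· ≤ ·) = l := by
      rw [Multiset.coe_sort]
      apply List.mergeSort_of_pairwise
      exact hd.imp fun h => by have := h.1; simp; omega
    refine ⟨⟨l, fun {i} hi => by have := ha i (by simpa using hi); omega, by simpa using hs⟩,
      ⟨⟨by simpa using hl, ?_⟩, by simpa using ha⟩, hsort⟩
    rw [hsort]
    exact List.isChain_iff_pairwise.2 hd

theorem D22_eq_ncard_ggLists (n m : ℕ) : D22 n m = (ggLists 1 n m).ncard := by
  rw [← ncard_ggPartitions_ge le_rfl, D22]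
  congr 1
  ext p
  simp only [Set.mem_ofPred_eq, iff_self_and]
  exact fun _ a ha => p.parts_pos ha

theorem D21_eq_ncard_ggLists (n m : ℕ) : D21 n m = (ggLists 3 n m).ncard :=
  ncard_ggPartitions_ge (by norm_num) n m

theorem ncard_ggLists_add_two (k n m : ℕ) :
    (ggLists (k + 2) n m).ncard = if 2 * m ≤ n then (ggLists k (n - 2 * m) m).ncard else 0 := by
  have hsum : ∀ l : List ℕ, (l.map (· + 2)).sum = l.sum + 2 * l.length := by
    intro l
    induction l with
    | nil => simp
    | cons a l ih => simp [ih]; ring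
  have hsurj : ∀ l : List ℕ, (∀ a ∈ l, k + 2 ≤ a) → (l.map (· - 2)).map (· + 2) = l := by
    intro l ha
    rw [List.map_map]
    conv_rhs => rw [← List.map_id l]
    refine List.map_congr_left fun a h => ?_
    have := ha a h
    simp
    omega
  have himage : ggLists (k + 2) n m =
      {l | 2 * m ≤ n ∧ l ∈ List.map (· + 2) '' ggLists k (n - 2 * m) m} := by
    ext l
    constructor
    · rintro ⟨hd, ha, hl, hs⟩
      have h := hsurj l ha
      have hs' := hsum (l.map (· - 2))
      rw [h, List.length_map, hl, hs] at hs'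
      refine ⟨by omega, l.map (· - 2), ⟨?_, ?_, by simpa using hl, by omega⟩, h⟩
      · rw [← h, List.pairwise_map] at hd
        exact hd.imp GGDiff.add_two_iff.1
      · intro b hb
        obtain ⟨a, h1, rfl⟩ := List.mem_map.1 hb
        have := ha a h1
        omega
    · rintro ⟨hn, l, ⟨hd, ha, hl, hs⟩, rfl⟩
      refine ⟨?_, ?_, by simpa using hl, by rw [hsum]; omega⟩
      · rw [List.pairwise_map]
        exact hd.imp GGDiff.add_two_iff.2
      · intro b hb
        obtain ⟨a, h1, rfl⟩ := List.mem_map.1 hb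
        have := ha a h1
        omega
  rw [himage]
  split_ifs with h
  · simp only [h, true_and, Set.ofPred_mem_eq]
    exact Set.ncard_image_of_injective _ (List.map_injective_iff.2 (add_left_injective 2))
  · simp [h]

theorem cons_mem_ggLists {k n m a : ℕ} {l : List ℕ} :
    a :: l ∈ ggLists k n (m + 1) ↔
      k ≤ a ∧ a ≤ n ∧ (∀ b ∈ l, GGDiff a b) ∧ l ∈ ggLists k (n - a) m := by
  simp only [ggLists, Set.mem_ofPred_eq, List.pairwise_cons, List.forall_mem_cons,
    List.length_cons, List.sum_cons]
  constructor
  · rintro ⟨⟨h1, h2⟩, ⟨h3, h4⟩, h5, h6⟩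
    exact ⟨h3, by omega, h1, h2, h4, by omega, by omega⟩
  · rintro ⟨h3, h7, h1, h2, h4, h5, h6⟩
    exact ⟨⟨h1, h2⟩, ⟨h3, h4⟩, by omega, by omega⟩

theorem ggLists_mono {k k' : ℕ} (h : k ≤ k') (n m : ℕ) : ggLists k' n m ⊆ ggLists k n m :=
  fun _ hl => ⟨hl.1, fun a ha => h.trans (hl.2.1 a ha), hl.2.2⟩

/-- Classification of the lists by their smallest part, which is `1`, `2`, or at least `3`. -/
theorem ggLists_one_succ (n m : ℕ) :
    ggLists 1 n (m + 1) = ggLists 3 n (m + 1) ∪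
      ({l | 1 ≤ n ∧ l ∈ List.cons 1 '' ggLists 3 (n - 1) m} ∪
        {l | 2 ≤ n ∧ l ∈ List.cons 2 '' ggLists 5 (n - 2) m}) := by
  ext l
  constructor
  · intro hl
    cases l with
    | nil => exact absurd hl.2.2.1 (by simp)
    | cons a l =>
      have hl' := cons_mem_ggLists.1 hl
      obtain ⟨h1, h2, h3, h4⟩ := hl'
      rcases Nat.lt_or_ge a 3 with h | h
      · right
        rcases (show a = 1 ∨ a = 2 by omega) with rfl | rfl
        · exact Or.inl ⟨h2, l, ⟨h4.1, fun b hb => ggDiff_one_iff.1 (h3 b hb),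
            h4.2.2⟩, rfl⟩
        · exact Or.inr ⟨h2, l, ⟨h4.1, fun b hb => ggDiff_two_iff.1 (h3 b hb), h4.2.2⟩, rfl⟩
      · left
        refine cons_mem_ggLists.2 ⟨h, h2, h3, h4.1, fun b hb => ?_, h4.2.2⟩
        have := (h3 b hb).1
        omega
  · rintro (hl | ⟨hn, l, hl, rfl⟩ | ⟨hn, l, hl, rfl⟩)
    · exact ggLists_mono (by norm_num) _ _ hl
    · exact cons_mem_ggLists.2 ⟨le_rfl, hn, fun b hb => ggDiff_one_iff.2 (hl.2.1 b hb),
        ggLists_mono (by norm_num) _ _ hl⟩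
    · exact cons_mem_ggLists.2 ⟨by norm_num, hn, fun b hb => ggDiff_two_iff.2 (hl.2.1 b hb),
        ggLists_mono (by norm_num) _ _ hl⟩

theorem ncard_cons_image (c k n m : ℕ) :
    {l | c ≤ n ∧ l ∈ List.cons c '' ggLists k (n - c) m}.ncard =
      if c ≤ n then (ggLists k (n - c) m).ncard else 0 := by
  split_ifs with h
  · simp only [h, true_and, Set.ofPred_mem_eq]
    exact Set.ncard_image_of_injective _ (List.cons_injective)
  · simp [h]

theorem finite_cons_image (c k n m : ℕ) :
    {l | c ≤ n ∧ l ∈ List.cons c '' ggLists k (n - c) m}.Finite :=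
  ((finite_ggLists k (n - c) m).image (List.cons c)).subset fun _ hl => hl.2

theorem ncard_ggLists_one_succ (n m : ℕ) :
    (ggLists 1 n (m + 1)).ncard = (ggLists 3 n (m + 1)).ncard +
      ((if 1 ≤ n then (ggLists 3 (n - 1) m).ncard else 0) +
        if 2 ≤ n then (ggLists 5 (n - 2) m).ncard else 0) := by
  rw [ggLists_one_succ, Set.ncard_union_eq _ (finite_ggLists _ _ _)
    ((finite_cons_image _ _ _ _).union (finite_cons_image _ _ _ _)),
    Set.ncard_union_eq _ (finite_cons_image _ _ _ _) (finite_cons_image _ _ _ _),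
    ncard_cons_image, ncard_cons_image]
  · rw [Set.disjoint_left]
    rintro _ ⟨_, l, _, rfl⟩ ⟨_, l', _, h⟩
    simp at h
  · rw [Set.disjoint_left]
    rintro l ⟨_, ha, _⟩ (⟨_, l, _, rfl⟩ | ⟨_, l, _, rfl⟩)
    · simpa using ha 1 (by simp)
    · simpa using ha 2 (by simp)

/-! ### Recurrence for the generating functions -/

/-- The generating function of `ggLists k · m` in the variable `q`. -/
noncomputable def ggSeries (k m : ℕ) : QXSeries := qSeries fun n => (ggLists k n m).ncard

theorem ggSeries_add_two (k m : ℕ) : ggSeries (k + 2) m = qVar ^ (2 * m) * ggSeries k m := by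
  ext e
  rw [ggSeries, ggSeries, coeff_qVar_pow_mul_qSeries, coeff_qSeries, ncard_ggLists_add_two]
  push_cast
  rfl

theorem ggSeries_one_succ (m : ℕ) :
    ggSeries 1 (m + 1) = ggSeries 3 (m + 1) +
      (qVar ^ 1 * ggSeries 3 m + qVar ^ 2 * ggSeries 5 m) := by
  ext e
  rw [map_add, map_add, ggSeries, ggSeries, ggSeries, ggSeries, coeff_qVar_pow_mul_qSeries,
    coeff_qVar_pow_mul_qSeries, coeff_qSeries, coeff_qSeries, ncard_ggLists_one_succ]
  split_ifs <;> simp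

theorem ggSeries_zero (k : ℕ) : ggSeries k 0 = 1 := by
  ext e
  have h : ∀ n, (ggLists k n 0) = if n = 0 then {[]} else ∅ := by
    intro n
    ext l
    cases l with
    | nil => by_cases hn : n = 0 <;> simp [ggLists, hn, eq_comm]
    | cons a l => split_ifs <;> simp [ggLists]
  have he : e = 0 ↔ e 1 = 0 ∧ e 0 = 0 := by
    rw [Finsupp.ext_iff, Fin.forall_fin_two, and_comm]
    rfl
  rw [ggSeries, coeff_qSeries, h, MvPowerSeries.coeff_one]
  by_cases h1 : e 1 = 0 <;> by_cases h0 : e 0 = 0 <;> simp [he, h1, h0]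

theorem ggSeries_recurrence (N : ℕ) :
    (1 - qVar ^ (2 * N + 2)) * ggSeries 1 (N + 1) =
      qVar ^ (2 * N + 1) * (1 + qVar ^ (2 * N + 1)) * ggSeries 1 N := by
  have h := ggSeries_one_succ N
  -- Parts at least 5 are shifted twice, giving `q^(4N)`; parts at least 3 once.
  rw [ggSeries_add_two 3, ggSeries_add_two 1, ggSeries_add_two 1] at h
  linear_combination h

theorem sum_weightPairs_eq_ggSeries_one (N : ℕ) :
    ∑ p ∈ weightPairs N, qVar ^ (N ^ 2 + p.1.choose 2) * ggDenomInv p.1 p.2 = ggSeries 1 N :=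
  sum_weightPairs_eq_of_recurrence _ (ggSeries_zero 1) ggSeries_recurrence N

/-! ### Exponents and conclusion -/

theorem exponent_eq (a b : ℕ) :
    4 * b ^ 2 + (3 * a ^ 2 - a) / 2 + 4 * b * a = (2 * b + a) ^ 2 + a.choose 2 := by
  have h : 3 * a ^ 2 - a = 2 * (a ^ 2 + a.choose 2) := by
    have h2 : a * (a - 1) = 2 * a.choose 2 := by
      rw [Nat.choose_two_right, Nat.two_mul_div_two_of_even (Nat.even_mul_pred_self a)]
    cases a with
    | zero => rfl
    | succ a =>
      rw [mul_add, ← h2, Nat.add_sub_cancel]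
      refine Nat.sub_eq_of_eq_add ?_
      ring
  rw [h, Nat.mul_div_cancel_left _ two_pos]
  ring

/-- The extra `2 * (2 * b + a)` is the cost of adding 2 to each of the `2 * b + a` parts. -/
theorem exponent_eq' (a b : ℕ) :
    4 * b ^ 2 + 4 * b + (3 * a ^ 2 + 3 * a) / 2 + 4 * b * a =
      2 * (2 * b + a) + ((2 * b + a) ^ 2 + a.choose 2) := by
  have h : 3 * a ^ 2 + 3 * a = 3 * a ^ 2 - a + 2 * a * 2 := by
    have : a ≤ a ^ 2 := Nat.le_self_pow two_ne_zero a
    omega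
  rw [← exponent_eq, h, Nat.add_mul_div_right _ _ two_pos]
  ring

theorem mainTheorem3 :
    HasSum
        (fun p : ℕ × ℕ =>
          qVar ^ (4 * p.2 ^ 2 + (3 * p.1 ^ 2 - p.1) / 2 + 4 * p.2 * p.1) *
            xVar ^ (2 * p.2 + p.1) * ggDenomInv p.1 p.2)
        (genFun D22) ∧
      HasSum
        (fun p : ℕ × ℕ =>
          qVar ^ (4 * p.2 ^ 2 + 4 * p.2 + (3 * p.1 ^ 2 + 3 * p.1) / 2 + 4 * p.2 * p.1) *
            xVar ^ (2 * p.2 + p.1) * ggDenomInv p.1 p.2)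
        (genFun D21) := by
  simp only [exponent_eq, exponent_eq', mul_comm (qVar ^ _) (xVar ^ _), mul_assoc (xVar ^ _)]
  constructor
  · apply hasSum_genFun_of_sum_weightPairs
    intro N
    simp only [D22_eq_ncard_ggLists]
    rw [← ggSeries, ← sum_weightPairs_eq_ggSeries_one]
    refine Finset.sum_congr rfl fun p hp => ?_
    rw [mem_weightPairs.1 hp]
  · apply hasSum_genFun_of_sum_weightPairs
    intro N
    simp only [D21_eq_ncard_ggLists]
    rw [← ggSeries, ggSeries_add_two 1, ← sum_weightPairs_eq_ggSeries_one, Finset.mul_sum]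
    refine Finset.sum_congr rfl fun p hp => ?_
    rw [mem_weightPairs.1 hp, pow_add, mul_assoc]
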